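/- All graphs are finite and have no multiple edges; loops are allowed. For a graph $G$ with vertices $v_1,\dots,v_n$ and $\ell$ loops, let $\mathcal A(G)$ be its $n\times n$ adjacency matrix over $GF(2)$ (loops give diagonal entries $1$), and let $$[G](A,B,d)=\sum_{\Delta}A^{\nu(\Delta)}B^{\rho(\Delta)}d^{\,\nu(\mathcal A(G)+\Delta)},$$ where $\Delta$ runs over all $n\times n$ diagonal matrices over $GF(2)$ and $\nu,\rho$ denote nullity and rank over $GF(2)$. Put $\langle G\rangle(A)=[G](A,A^{-1},-A^2-A^{-2})$, and define the graph Jones polynomial $$V_G(t)=(-1)^n\,t^{(3n-6\ell)/4}\,\langle G\rangle(t^{-1/4}),$$ a Laurent polynomial in $t^{1/4}$. Graphs are considered up to isomorphism. The graph Reidemeister moves are the following. $\Omega.1$: adjoin or remove an isolated vertex, which may be looped or unlooped. $\Omega.2$: adjoin or remove two vertices $v,w$ such that $v$ is looped, $w$ is not looped, and every vertex $x\notin\{v,w\}$ that is adjacent to one of $v,w$ is also adjacent to the other; $v$ and $w$ may be adjacent or not. $\Omega.3$: toggle the three non-loop adjacencies among three distinct vertices $u,v,w$, provided that every vertex $x\notin\{u,v,w\}$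 that is adjacent to any of $u,v,w$ is adjacent to precisely two of them, and that the subgraph spanned by $u,v,w$, either before or after the toggling, is isomorphic to one of these six three-vertex graphs: (i) a path with all three vertices looped; (ii) a path without loops; (iii) a path with loops at exactly its middle vertex and one end vertex; (iv) a path with a loop at exactly one end vertex; (v) a triangle with exactly two looped vertices; (vi) a triangle with exactly one looped vertex. Two graphs are Reidemeister equivalent if one can be obtained from the other by a finite sequence of these moves. **Theorem.** If $G$ and $H$ are Reidemeister equivalent graphs, then $V_G(t)=V_H(t)$. -/

import Mathlib

open scoped LaurentPolynomial

universe u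

/-- A graph on the vertex set `V`, with loops allowed and without multiple edges: its edges form a
set of unordered pairs `s(x, y)`, where `s(x, x)` is a loop at `x`. -/
@[ext]
structure LoopedGraph (V : Type*) where
  /-- the set of edges -/
  edges : Set (Sym2 V)

namespace LoopedGraph

variable {V W : Type*}

/-- `x` and `y` are joined by an edge; `G.Adj x x` says that there is a loop at `x`. -/
def Adj (G : LoopedGraph V) (x y : V) : Prop := s(x, y) ∈ G.edges

/-- The number of loops. -/
noncomputable def numLoops (G : LoopedGraph V) : ℕ := {x : V | G.Adj x x}.ncard

/-- The full subgraph spanned by a set of vertices. -/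
def induce (G : LoopedGraph V) (s : Set V) : LoopedGraph s where
  edges := {e | e.map Subtype.val ∈ G.edges}

/-- The two graphs are isomorphic. -/
def IsIso (G : LoopedGraph V) (H : LoopedGraph W) : Prop :=
  ∃ e : V ≃ W, ∀ x y : V, G.Adj x y ↔ H.Adj (e x) (e y)

/-- The graph obtained by toggling the three (non-loop) adjacencies among `u`, `v`, `w`;
it is used for distinct `u`, `v`, `w`. -/
def toggle (G : LoopedGraph V) (u v w : V) : LoopedGraph V where
  edges := symmDiff G.edges {s(u, v), s(u, w), s(v, w)}

open Classical in
/-- The Boolean adjacency matrix over `GF(2)`, with the loops on the diagonal. -/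
noncomputable def adjMatrix (G : LoopedGraph V) : Matrix V V (ZMod 2) :=
  Matrix.of fun x y => if G.Adj x y then 1 else 0

/-- The nullity of a square matrix over `GF(2)`. -/
noncomputable def nullity [Fintype V] (M : Matrix V V (ZMod 2)) : ℕ :=
  Module.finrank (ZMod 2) (LinearMap.ker M.mulVecLin)

open Classical in
/-- The graph bracket polynomial `[G](A, B, d)`, a polynomial in the variables
`A = X 0`, `B = X 1`, `d = X 2`; the sum runs over all diagonal matrices `Δ` over `GF(2)`. -/
noncomputable def bracket [Fintype V] (G : LoopedGraph V) : MvPolynomial (Fin 3) ℤ :=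
  ∑ Δ : V → ZMod 2,
    MvPolynomial.X 0 ^ nullity (Matrix.diagonal Δ) *
      MvPolynomial.X 1 ^ (Matrix.diagonal Δ).rank *
      MvPolynomial.X 2 ^ nullity (G.adjMatrix + Matrix.diagonal Δ)

/-- The reduced graph bracket `⟨G⟩(A) = [G](A, A⁻¹, -A² - A⁻²)`, a Laurent polynomial in
`A = T 1`. -/
noncomputable def reducedBracket [Fintype V] (G : LoopedGraph V) : ℤ[T;T⁻¹] :=
  MvPolynomial.aeval
    ![LaurentPolynomial.T 1, LaurentPolynomial.T (-1),
      -LaurentPolynomial.T 2 - LaurentPolynomial.T (-2)] G.bracket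

/-- The graph Jones polynomial `V_G(t) = (-1)ⁿ t^((3n - 6ℓ)/4) ⟨G⟩(t^(-1/4))`, as a Laurent
polynomial in `t^(1/4)`: here `T k` stands for `t^(k/4)`, and `LaurentPolynomial.invert` is the
substitution of `T (-1) = t^(-1/4)` for the variable `A = T 1` of `⟨G⟩`. -/
noncomputable def jones [Fintype V] (G : LoopedGraph V) : ℤ[T;T⁻¹] :=
  (-1) ^ Fintype.card V *
    LaurentPolynomial.T (3 * (Fintype.card V : ℤ) - 6 * (G.numLoops : ℤ)) *
    LaurentPolynomial.invert G.reducedBracket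

/-- `H` is obtained from `G`, up to isomorphism, by adjoining an isolated vertex, which may be
looped or not. -/
def Omega1 (G : LoopedGraph V) (H : LoopedGraph W) : Prop :=
  ∃ v : W, (∀ x : W, x ≠ v → ¬ H.Adj x v) ∧ G.IsIso (H.induce {x | x ≠ v})

/-- `H` is obtained from `G`, up to isomorphism, by adjoining a looped vertex `v` and an unlooped
vertex `w` that have the same neighbours outside `{v, w}` and may be adjacent or not. -/
def Omega2 (G : LoopedGraph V) (H : LoopedGraph W) : Prop :=
  ∃ v w : W, H.Adj v v ∧ ¬ H.Adj w w ∧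
    (∀ x : W, x ≠ v → x ≠ w → (H.Adj x v ↔ H.Adj x w)) ∧
    G.IsIso (H.induce {x | x ≠ v ∧ x ≠ w})

/-- The six three-vertex configurations: a path with all three vertices looped, or none, or its
middle and one end vertex looped, or one end vertex looped; a triangle with two loops, or
with one. -/
def omega3Graph : Fin 6 → LoopedGraph (Fin 3) :=
  ![⟨{s(0, 0), s(1, 1), s(2, 2), s(0, 1), s(1, 2)}⟩,
    ⟨{s(0, 1), s(1, 2)}⟩,
    ⟨{s(0, 0), s(1, 1), s(0, 1), s(1, 2)}⟩,
    ⟨{s(2, 2), s(0, 1), s(1, 2)}⟩,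
    ⟨{s(0, 0), s(1, 1), s(0, 1), s(0, 2), s(1, 2)}⟩,
    ⟨{s(0, 0), s(0, 1), s(0, 2), s(1, 2)}⟩]

/-- `H` is obtained from `G`, up to isomorphism, by toggling the non-loop adjacencies among three
distinct vertices `u`, `v`, `w` such that every outside vertex adjacent to any of them is adjacent
to precisely two of them, and such that `u`, `v`, `w` span one of the six configurations before or
after the toggling. -/
def Omega3 (G : LoopedGraph V) (H : LoopedGraph W) : Prop :=
  ∃ u v w : V, u ≠ v ∧ u ≠ w ∧ v ≠ w ∧
    (∀ x : V, x ∉ ({u, v, w} : Set V) → (∃ y ∈ ({u, v, w} : Set V), G.Adj x y) →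
      {y ∈ ({u, v, w} : Set V) | G.Adj x y}.ncard = 2) ∧
    (∃ k : Fin 6, (G.induce {u, v, w}).IsIso (omega3Graph k) ∨
      ((G.toggle u v w).induce {u, v, w}).IsIso (omega3Graph k)) ∧
    (G.toggle u v w).IsIso H

end LoopedGraph

/-- A finite looped graph together with its vertex set. -/
structure FiniteLoopedGraph : Type (u + 1) where
  /-- the vertices -/
  Vert : Type u
  /-- the vertex set is finite -/
  [fintypeVert : Fintype Vert]
  /-- the looped graph on these vertices -/
  graph : LoopedGraph Vert

namespace FiniteLoopedGraph

attribute [instance] FiniteLoopedGraph.fintypeVert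

/-- `H` is obtained from `G` by a single move, where the first two moves adjoin vertices. -/
def Move (G H : FiniteLoopedGraph.{u}) : Prop :=
  G.graph.Omega1 H.graph ∨ G.graph.Omega2 H.graph ∨ G.graph.Omega3 H.graph

/-- Reidemeister equivalence: some finite sequence of moves and inverse moves leads from `G`
to `H`. -/
def ReidemeisterEquiv (G H : FiniteLoopedGraph.{u}) : Prop :=
  Relation.EqvGen Move G H

/-- The graph Jones polynomial of a finite looped graph. -/
noncomputable def jones (G : FiniteLoopedGraph.{u}) : LaurentPolynomial ℤ := G.graph.jones

end FiniteLoopedGraph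

/-!
For a symmetric matrix `K` over `GF(2)` let `stateSum K` be the sum over all diagonals `Δ` of
`weight Δ * d ^ ν(K + Δ)`, with `d = -A² - A⁻²`; the reduced bracket of a graph is the state sum of
its adjacency matrix. Each move concerns a block `S` of one, two or three vertices, whose indicator
vector `g` satisfies `K g = 0` outside `S`. On `S` let `κ` be the row sums `K g`. The diagonals that
agree outside `S` are `Δ + 1_T`, for `T ⊆ S` and for the unique `Δ` among them with `Δ = κ` on `S`
(`sum_eq_sum_filter_sum_powerset`). This base point is chosen so that `M = K + Δ` has `M g = 0`, and
the nullities of the matrices `M + 1_T` can be compared by three facts: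

* `nullity_eq_nullity_add_single`: changing one diagonal entry of `M` in `S` lowers the nullity
  by one;
* `nullity_add_vecMulVec`: a congruence by `1 + g cᵀ` with `c ⊥ g` changes a symmetric matrix by
  an explicit matrix of rank at most two, and preserves the nullity;
* `nullity_eq_nullity_submatrix`: if all entries in `S` are changed and `S` has one or two elements,
  then the nullity is that of the matrix with `S` deleted.

In the first move the two terms add up to `-A³` or `-A⁻³` times a term for the smaller graph,
which is what the power of `t` and the sign in the Jones polynomial compensate. In the second
move, `κ` takes both values on `S`, so the terms for `T = ∅, {v}, {w}` are multiples of the same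
power of `d` with coefficients proportional to `d`, `A²`, `A⁻²`, and cancel; the fourth is the
term for the smaller graph. In the third move, the congruences show that toggling preserves the
terms with `|T| = 2`, and that the matrices `M + 1_T` with `|T| = 1` before toggling have the
nullity of `M + 1_S` after toggling, and conversely. So both sides agree once the coefficient
`d + a + b + c` of the terms with `|T| ≤ 1` equals that of `T = S`, which is `a b c`, where
`a, b, c ∈ {A², A⁻²}` are determined by `κ`. This holds if `a, b, c` are not all equal, that is, if the
degrees in the subgraph spanned by `S` do not all have the same parity. The six configurations
have this property (`not_degreeParityConst_omega3Graph`), and toggling does not affect it.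
-/

namespace LoopedGraph

open Matrix

/-! ### Nullities of symmetric matrices over `GF(2)` -/

section Nullity

variable {V : Type*} [Fintype V]

theorem nullity_add_rank (M : Matrix V V (ZMod 2)) : nullity M + M.rank = Fintype.card V := by
  have h := LinearMap.finrank_range_add_finrank_ker M.mulVecLin
  rw [Module.finrank_fintype_fun_eq_card] at h
  rw [add_comm]
  exact h

theorem nullity_submatrix_equiv {W : Type*} [Fintype W] (e : V ≃ W) (M : Matrix W W (ZMod 2)) :
    nullity (M.submatrix e e) = nullity M := by
  have h := nullity_add_rank (M.submatrix e e)
  rw [rank_submatrix, Fintype.card_congr e, ← nullity_add_rank M] at h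
  exact Nat.add_right_cancel h

theorem dotProduct_mulVec_of_isSymm {M : Matrix V V (ZMod 2)} (hM : M.IsSymm)
    (x g : V → ZMod 2) : g ⬝ᵥ M *ᵥ x = (M *ᵥ g) ⬝ᵥ x := by
  rw [dotProduct_mulVec, ← mulVec_transpose, hM.eq]

/-- Vertices can be deleted without changing the nullity when the indicator vector `g` of the set of
deleted vertices is fixed by `M`, and when that set has at most two elements; the last condition
appears as `hd`: a vector orthogonal to `g` is constant on the deleted vertices. Then restriction
to `s` identifies the two kernels. -/
theorem nullity_eq_nullity_submatrix {M : Matrix V V (ZMod 2)} (hM : M.IsSymm) {s : Set V}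
    [Fintype s] {g : V → ZMod 2} (hg : M *ᵥ g = g) (h0 : ∀ i ∈ s, g i = 0)
    (h1 : ∀ i ∉ s, g i = 1)
    (hd : ∀ x : V → ZMod 2, g ⬝ᵥ x = 0 → ∃ a : ZMod 2, ∀ i ∉ s, x i = a) :
    nullity M = nullity (M.submatrix (Subtype.val : s → V) Subtype.val) := by
  classical
  set N : Matrix s s (ZMod 2) := M.submatrix (Subtype.val : s → V) Subtype.val with hN
  have hsub (z : V → ZMod 2) (hz : ∀ i ∉ s, z i = 0) (i : s) :
      (N *ᵥ fun j : s => z j) i = (M *ᵥ z) i := by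
    change ∑ j : s, M i j * z j = ∑ j, M i j * z j
    rw [Finset.sum_set_coe s (f := fun j => M i j * z j)]
    refine Finset.sum_subset (Finset.subset_univ _) fun j _ hj => ?_
    rw [hz j (by simpa using hj), mul_zero]
  -- Adding a multiple of `g` reduces this to the case of a vector vanishing off `s`.
  have hconst (x : V → ZMod 2) (a : ZMod 2) (hx : ∀ i ∉ s, x i = a) (i : s) :
      (N *ᵥ fun j : s => x j) i = (M *ᵥ x) i := by
    have h := hsub (x + a • g) (fun i hi => by simp [hx i hi, h1 i hi, CharTwo.add_self_eq_zero]) i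
    simpa [mulVec_add, mulVec_smul, hg, h0] using h
  have hker (x : V → ZMod 2) (hx : M *ᵥ x = 0) : ∃ a : ZMod 2, ∀ i ∉ s, x i = a :=
    hd x (by rw [← hg, ← dotProduct_mulVec_of_isSymm hM, hx, dotProduct_zero])
  let r : LinearMap.ker M.mulVecLin →ₗ[ZMod 2] LinearMap.ker N.mulVecLin :=
    (LinearMap.funLeft (ZMod 2) (ZMod 2) ((↑) : s → V)).restrict fun x hx => by
      have hx' : M *ᵥ x = 0 := hx
      obtain ⟨a, ha⟩ := hker x hx'
      change N *ᵥ _ = 0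
      ext i
      exact (hconst x a ha i).trans (congrFun hx' i)
  unfold nullity
  refine (LinearEquiv.ofBijective r ⟨?_, ?_⟩).finrank_eq
  · refine (injective_iff_map_eq_zero r).2 fun ⟨x, hx⟩ hr => ?_
    have hx' : M *ᵥ x = 0 := hx
    obtain ⟨a, ha⟩ := hker x hx'
    have hr' (i : V) (hi : i ∈ s) : x i = 0 :=
      congrFun (congrArg Subtype.val hr) ⟨i, hi⟩
    have hxa : x = a • g := by
      ext i
      by_cases hi : i ∈ s
      · simp [hr' i hi, h0 i hi]
      · simp [ha i hi, h1 i hi]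
    have : x = 0 := by
      rw [← hx', hxa, mulVec_smul, hg]
    exact Subtype.ext this
  · rintro ⟨y, hy⟩
    have hy' : N *ᵥ y = 0 := hy
    set z : V → ZMod 2 := fun i => if h : i ∈ s then y ⟨i, h⟩ else 0 with hz
    have hzs (i : V) (hi : i ∉ s) : z i = 0 := by simp [hz, hi]
    have hzy : (fun j : s => z j) = y := by
      ext j
      simp [hz]
    have hMz (i : V) (hi : i ∈ s) : (M *ᵥ z) i = 0 := by
      rw [← hsub z hzs ⟨i, hi⟩, hzy, hy']
      rfl
    have hgz : g ⬝ᵥ z = 0 := Finset.sum_eq_zero fun i _ => by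
      by_cases hi : i ∈ s
      · simp [h0 i hi]
      · simp [hzs i hi]
    obtain ⟨a, ha⟩ := hd (M *ᵥ z) (by rw [dotProduct_mulVec_of_isSymm hM, hg, hgz])
    have hMza : M *ᵥ z = a • g := by
      ext i
      by_cases hi : i ∈ s
      · simp [hMz i hi, h0 i hi]
      · simp [ha i hi, h1 i hi]
    refine ⟨⟨z + a • g, ?_⟩, ?_⟩
    · change M *ᵥ (z + a • g) = 0
      rw [mulVec_add, mulVec_smul, hg, hMza]
      exact ZModModule.add_self _
    · refine Subtype.ext ?_
      ext j
      change z j + a * g j = y j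
      rw [h0 j j.2, mul_zero, add_zero]
      exact congrFun hzy j

variable [DecidableEq V]

/-- A congruence: the left-hand matrix is `Pᵀ * M * P` for `P = 1 + g * cᵀ`, which is its own
inverse since `c` and `g` are orthogonal and the characteristic is two. -/
theorem nullity_add_vecMulVec {M : Matrix V V (ZMod 2)} (hM : M.IsSymm) {g c σ : V → ZMod 2}
    (hσ : M *ᵥ g = σ) (hc : c ⬝ᵥ g = 0) :
    nullity (M + vecMulVec c σ + vecMulVec σ c + (g ⬝ᵥ σ) • vecMulVec c c) = nullity M := by
  set P : Matrix V V (ZMod 2) := 1 + vecMulVec g c with hP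
  have hPP : P * P = 1 := by
    rw [hP, add_mul, mul_add, mul_add, vecMulVec_mul_vecMulVec, hc]
    have h2 : vecMulVec g c + vecMulVec g c = 0 := by
      ext i j
      exact CharTwo.add_self_eq_zero _
    simp [add_assoc, h2]
  have hdet : IsUnit P.det := IsUnit.of_mul_eq_one _ (by rw [← det_mul, hPP, det_one])
  have hconj : Pᵀ * M * P =
      M + vecMulVec c σ + vecMulVec σ c + (g ⬝ᵥ σ) • vecMulVec c c := by
    have h1 : g ᵥ* M = σ := by rw [← mulVec_transpose, hM.eq, hσ]
    rw [hP, transpose_add, transpose_one, transpose_vecMulVec, add_mul, mul_add, add_mul, add_mul,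
      vecMulVec_mul, h1]
    simp only [Matrix.one_mul, Matrix.mul_one, mul_vecMulVec, hσ]
    rw [vecMulVec_mulVec, dotProduct_comm g σ]
    ext i j
    simp [vecMulVec_apply]
    ring
  have hr : (Pᵀ * M * P).rank = M.rank := by
    rw [rank_mul_eq_left_of_isUnit_det _ _ hdet,
      rank_mul_eq_right_of_isUnit_det _ _ (by rwa [det_transpose])]
  have h := nullity_add_rank (Pᵀ * M * P)
  rw [hr, ← nullity_add_rank M, hconj] at h
  exact Nat.add_right_cancel h

/-- If `g` is in the kernel of `M` and `g u = 1`, then changing the diagonal entry at `u` cuts the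
kernel down to its intersection with the hyperplane `x u = 0`, which does not contain `g`. -/
theorem nullity_eq_nullity_add_single {M : Matrix V V (ZMod 2)} (hM : M.IsSymm) {g : V → ZMod 2}
    (hg : M *ᵥ g = 0) {u : V} (hu : g u = 1) :
    nullity M = nullity (M + diagonal (Pi.single u 1)) + 1 := by
  set p := LinearMap.ker M.mulVecLin with hp
  set p' := LinearMap.ker (M + diagonal (Pi.single u 1)).mulVecLin with hp'
  have hmem (x : V → ZMod 2) : x ∈ p' ↔ x ∈ p ∧ x u = 0 := by
    have hx : (M + diagonal (Pi.single u 1)) *ᵥ x = M *ᵥ x + Pi.single u (x u) := by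
      rw [add_mulVec]
      congr 1
      ext i
      rcases eq_or_ne i u with rfl | hi <;> simp [mulVec_diagonal, *]
    simp only [hp, hp', LinearMap.mem_ker, mulVecLin_apply, hx]
    constructor
    · intro h
      have h0 := congrArg (g ⬝ᵥ ·) h
      simp only [dotProduct_add, dotProduct_mulVec_of_isSymm hM, hg, dotProduct_single, hu,
        zero_dotProduct, dotProduct_zero, zero_add, one_mul] at h0
      rw [h0] at h
      exact ⟨by simpa using h, h0⟩
    · rintro ⟨h, h0⟩
      simp [h, h0]
  let f : Module.Dual (ZMod 2) p := (LinearMap.proj u).domRestrict p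
  have hf : f ≠ 0 := fun h => by
    have := LinearMap.congr_fun h ⟨g, by simpa [hp] using hg⟩
    simp [f, hu] at this
  have hker : LinearMap.ker f = p'.comap p.subtype := by
    ext x
    simp [f, hmem]
  have hle : p' ≤ p := fun x hx => ((hmem x).1 hx).1
  have h := Module.Dual.finrank_ker_add_one_of_ne_zero hf
  rw [hker, (Submodule.comapSubtypeEquivOfLe hle).finrank_eq] at h
  exact h.symm

end Nullity

/-! ### Splitting a sum over diagonal matrices along a set of vertices -/

section BlockSum

variable {V : Type*} [DecidableEq V]

theorem sum_powerset_singleton {R : Type*} [AddCommMonoid R] (F : Finset V → R) (v : V) :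
    ∑ T ∈ ({v} : Finset V).powerset, F T = F ∅ + F {v} := by
  rw [← insert_empty_eq v, Finset.sum_powerset_insert (Finset.notMem_empty v)]
  simp

theorem sum_powerset_pair {R : Type*} [AddCommMonoid R] (F : Finset V → R) {v w : V}
    (hvw : v ≠ w) :
    ∑ T ∈ ({v, w} : Finset V).powerset, F T = F ∅ + F {w} + (F {v} + F {v, w}) := by
  rw [Finset.sum_powerset_insert (by simpa using hvw), sum_powerset_singleton,
    sum_powerset_singleton (fun T => F (insert v T)), insert_empty_eq]

theorem sum_powerset_triple {R : Type*} [AddCommMonoid R] (F : Finset V → R) {u v w : V}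
    (huv : u ≠ v) (huw : u ≠ w) (hvw : v ≠ w) :
    ∑ T ∈ ({u, v, w} : Finset V).powerset, F T =
      F ∅ + F {w} + (F {v} + F {v, w}) + (F {u} + F {u, w} + (F {u, v} + F {u, v, w})) := by
  rw [Finset.sum_powerset_insert (by simp [huv, huw]), sum_powerset_pair F hvw,
    sum_powerset_pair (fun T => F (insert u T)) hvw, insert_empty_eq]

variable [Fintype V]

/-- Every diagonal is, in a unique way, the sum of a diagonal that agrees with `κ` on `S` and of the
indicator function of a subset of `S`. -/
theorem sum_eq_sum_filter_sum_powerset {R : Type*} [AddCommMonoid R] (κ : V → ZMod 2)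
    (F : (V → ZMod 2) → R) (S : Finset V) :
    ∑ Δ, F Δ = ∑ Δ : V → ZMod 2 with ∀ i ∈ S, Δ i = κ i,
      ∑ T ∈ S.powerset, F (Δ + ∑ i ∈ T, Pi.single i 1) := by
  induction S using Finset.induction_on with
  | empty => simp
  | insert a S ha ih =>
    rw [ih, ← Finset.sum_filter_add_sum_filter_not _ (fun Δ => Δ a = κ a)]
    simp only [Finset.sum_powerset_insert ha, Finset.sum_add_distrib, Finset.filter_filter]
    congr 1
    · refine Finset.sum_congr (Finset.filter_congr fun Δ _ => ?_) fun _ _ => rfl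
      simp [and_comm]
    · refine Finset.sum_nbij' (· + Pi.single a 1) (· + Pi.single a 1) ?_ ?_ ?_ ?_ ?_
      · simp only [Finset.mem_filter_univ, Finset.forall_mem_insert, Pi.add_apply,
          Pi.single_eq_same]
        rintro Δ ⟨h, hne⟩
        refine ⟨?_, fun i hi => ?_⟩
        · revert hne
          generalize Δ a = x
          generalize κ a = y
          revert x y
          decide
        · rw [Pi.single_eq_of_ne (ne_of_mem_of_not_mem hi ha), add_zero, h i hi]
      · simp only [Finset.mem_filter_univ, Finset.forall_mem_insert, Pi.add_apply,
          Pi.single_eq_same]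
        rintro Δ ⟨hne, h⟩
        refine ⟨fun i hi => ?_, ?_⟩
        · rw [Pi.single_eq_of_ne (ne_of_mem_of_not_mem hi ha), add_zero, h i hi]
        · simp [hne]
      · intro Δ _
        simp [add_assoc, ZModModule.add_self]
      · intro Δ _
        simp [add_assoc, ZModModule.add_self]
      · intro Δ _
        refine Finset.sum_congr rfl fun T hT => ?_
        have haT : a ∉ T := fun h => ha (Finset.mem_powerset.1 hT h)
        rw [Finset.sum_insert haT, ← add_assoc, add_assoc Δ, ZModModule.add_self, add_zero]

theorem sum_filter_restrict {R : Type*} [AddCommMonoid R] (κ : V → ZMod 2) (s : Set V)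
    [Fintype s] {S : Finset V} (hS : ∀ i, i ∈ S ↔ i ∉ s) (F : (s → ZMod 2) → R) :
    ∑ Δ : V → ZMod 2 with ∀ i ∈ S, Δ i = κ i, F (fun i => Δ i) = ∑ Δ : s → ZMod 2, F Δ := by
  classical
  refine Finset.sum_nbij' (fun Δ i => Δ i) (fun Δ i => if h : i ∈ s then Δ ⟨i, h⟩ else κ i)
    ?_ ?_ ?_ ?_ ?_
  · simp
  · intro Δ _
    simp +contextual [hS]
  · intro Δ hΔ
    ext i
    by_cases hi : i ∈ s
    · simp [hi]
    · simpa [hi] using ((Finset.mem_filter_univ _).1 hΔ i ((hS i).2 hi)).symm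
  · intro Δ _
    ext i
    simp
  · simp

end BlockSum

/-! ### The matrix of a triangle -/

section Triangle

variable {V : Type*} [DecidableEq V]

theorem isSymm_add_diagonal {M : Matrix V V (ZMod 2)} (hM : M.IsSymm) (Δ : V → ZMod 2) :
    (M + diagonal Δ).IsSymm :=
  hM.add (isSymm_diagonal Δ)

theorem add_diagonal_add (M : Matrix V V (ZMod 2)) (Δ Θ : V → ZMod 2) :
    M + diagonal (Δ + Θ) = M + diagonal Δ + diagonal Θ := by
  rw [add_assoc, diagonal_add]
  rfl

/-- The adjacency matrix of the loopless triangle on `u`, `v`, `w` (and all other vertices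
isolated), for distinct `u`, `v`, `w`. -/
def triangleMatrix (u v w : V) : Matrix V V (ZMod 2) :=
  vecMulVec (Pi.single u 1) (Pi.single v 1) + vecMulVec (Pi.single v 1) (Pi.single u 1) +
  (vecMulVec (Pi.single u 1) (Pi.single w 1) + vecMulVec (Pi.single w 1) (Pi.single u 1)) +
  (vecMulVec (Pi.single v 1) (Pi.single w 1) + vecMulVec (Pi.single w 1) (Pi.single v 1))

theorem triangleMatrix_comm_left (u v w : V) : triangleMatrix u v w = triangleMatrix v u w := by
  simp only [triangleMatrix]
  abel

theorem triangleMatrix_comm_right (u v w : V) : triangleMatrix u v w = triangleMatrix u w v := by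
  simp only [triangleMatrix]
  abel

theorem isSymm_triangleMatrix (u v w : V) : (triangleMatrix u v w).IsSymm := by
  simp only [Matrix.IsSymm, triangleMatrix, transpose_add, transpose_vecMulVec]
  abel

theorem triangleMatrix_add_self (u v w : V) : triangleMatrix u v w + triangleMatrix u v w = 0 := by
  ext i j
  exact CharTwo.add_self_eq_zero (triangleMatrix u v w i j)

theorem diagonal_single_one (u : V) :
    diagonal (Pi.single u (1 : ZMod 2)) = vecMulVec (Pi.single u 1) (Pi.single u 1) := by
  ext i j
  rw [diagonal_apply, vecMulVec_apply]
  by_cases hi : i = u <;> by_cases hj : j = u <;> by_cases hij : i = j <;> simp_all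

variable [Fintype V]

theorem triangleMatrix_mulVec {u v w : V} (huv : u ≠ v) (huw : u ≠ w) (hvw : v ≠ w) :
    triangleMatrix u v w *ᵥ (Pi.single u 1 + Pi.single v 1 + Pi.single w 1) = 0 := by
  simp only [triangleMatrix, add_mulVec, vecMulVec_mulVec]
  simp [huv, huw, hvw, huv.symm, huw.symm, hvw.symm]
  ext i
  simp
  linear_combination ((Pi.single u 1 : V → ZMod 2) i + (Pi.single v 1 : V → ZMod 2) i +
    (Pi.single w 1 : V → ZMod 2) i) * CharTwo.two_eq_zero (R := ZMod 2)

/-- The congruence of `nullity_add_vecMulVec` for `c = e_v + e_w`. -/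
theorem nullity_add_single_eq_triangle {M : Matrix V V (ZMod 2)} (hM : M.IsSymm) {u v w : V}
    (huv : u ≠ v) (huw : u ≠ w) (hvw : v ≠ w)
    (hcol : M *ᵥ (Pi.single u 1 + Pi.single v 1 + Pi.single w 1) = 0) :
    nullity (M + triangleMatrix u v w + diagonal (Pi.single u 1) + diagonal (Pi.single v 1) +
      diagonal (Pi.single w 1)) = nullity (M + diagonal (Pi.single u 1)) := by
  have hσ : (M + diagonal (Pi.single u 1)) *ᵥ (Pi.single u 1 + Pi.single v 1 + Pi.single w 1) =
      Pi.single u 1 := by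
    rw [add_mulVec, hcol, zero_add, diagonal_single_one, vecMulVec_mulVec]
    simp [huv.symm, huw.symm]
  rw [← nullity_add_vecMulVec (isSymm_add_diagonal hM _) hσ (c := Pi.single v 1 + Pi.single w 1)
    (by simp [huv, huw, hvw, hvw.symm, CharTwo.add_self_eq_zero])]
  congr 1
  simp only [diagonal_single_one, triangleMatrix]
  have : (Pi.single u 1 + Pi.single v 1 + Pi.single w 1 : V → ZMod 2) ⬝ᵥ Pi.single u 1 = 1 := by
    simp [huv, huw]
  rw [this, one_smul]
  simp only [vecMulVec_add, add_vecMulVec]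
  abel

/-- The congruence of `nullity_add_vecMulVec` for `c = e_u + e_w`. -/
theorem nullity_add_single_add_single_eq_triangle {M : Matrix V V (ZMod 2)} (hM : M.IsSymm)
    {u v w : V} (huv : u ≠ v) (huw : u ≠ w) (hvw : v ≠ w)
    (hcol : M *ᵥ (Pi.single u 1 + Pi.single v 1 + Pi.single w 1) = 0) :
    nullity (M + triangleMatrix u v w + diagonal (Pi.single u 1) + diagonal (Pi.single v 1)) =
      nullity (M + diagonal (Pi.single u 1) + diagonal (Pi.single v 1)) := by
  have hσ : (M + diagonal (Pi.single u 1) + diagonal (Pi.single v 1)) *ᵥ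
      (Pi.single u 1 + Pi.single v 1 + Pi.single w 1) = Pi.single u 1 + Pi.single v 1 := by
    rw [add_mulVec, add_mulVec, hcol, zero_add, diagonal_single_one, vecMulVec_mulVec,
      diagonal_single_one, vecMulVec_mulVec]
    simp [huv, huv.symm, huw.symm, hvw.symm]
  rw [← nullity_add_vecMulVec (isSymm_add_diagonal (isSymm_add_diagonal hM _) _) hσ
    (c := Pi.single u 1 + Pi.single w 1)
    (by simp [huw, hvw, huv.symm, huw.symm, CharTwo.add_self_eq_zero])]
  congr 1
  have : (Pi.single u 1 + Pi.single v 1 + Pi.single w 1 : V → ZMod 2) ⬝ᵥ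
      (Pi.single u 1 + Pi.single v 1) = 0 := by
    simp [huv, huw, hvw, huv.symm, CharTwo.add_self_eq_zero]
  rw [this, zero_smul, add_zero]
  simp only [vecMulVec_add, add_vecMulVec, triangleMatrix, diagonal_single_one]
  ext i j
  simp only [Matrix.add_apply]
  linear_combination (-vecMulVec (Pi.single u 1) (Pi.single u 1) i j) *
    CharTwo.two_eq_zero (R := ZMod 2)

end Triangle

/-! ### State sums of symmetric matrices -/

section StateSum

open LaurentPolynomial

/-- The factor `A` or `A⁻¹` that a diagonal entry `0` or `1` contributes to a term of the
bracket. -/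
noncomputable def smoothing (x : ZMod 2) : ℤ[T;T⁻¹] := T (if x = 0 then 1 else -1)

/-- The ratio `smoothing (x + 1) / smoothing x`. -/
noncomputable def smoothingChange (x : ZMod 2) : ℤ[T;T⁻¹] := T (if x = 0 then -2 else 2)

/-- The value `-A² - A⁻²` of the variable `d`. -/
noncomputable def circleValue : ℤ[T;T⁻¹] := -T 2 - T (-2)

theorem smoothing_add_one (x : ZMod 2) : smoothing (x + 1) = smoothing x * smoothingChange x := by
  obtain rfl | rfl : x = 0 ∨ x = 1 := by revert x; decide
  · simp only [smoothing, smoothingChange, zero_add, if_pos, one_ne_zero, if_false, ← T_add]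
    norm_num
  · simp only [smoothing, smoothingChange, if_pos, one_ne_zero, if_false, ← T_add,
      CharTwo.add_self_eq_zero]
    norm_num

theorem T_two_mul_T_neg_two : (T 2 * T (-2) : ℤ[T;T⁻¹]) = 1 := by
  rw [← T_add, add_neg_cancel, T_zero]

theorem T_one_mul_T_neg_one : (T 1 * T (-1) : ℤ[T;T⁻¹]) = 1 := by
  rw [← T_add, add_neg_cancel, T_zero]

variable {V : Type*} [Fintype V]

/-- The factor `A ^ ν(Δ) * A⁻¹ ^ ρ(Δ)` of a term of the reduced bracket, written as a product over
the vertices. -/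
noncomputable def weight (Δ : V → ZMod 2) : ℤ[T;T⁻¹] := ∏ i, smoothing (Δ i)

theorem weight_restrict (Δ : V → ZMod 2) (s : Set V) [Fintype s] {S : Finset V}
    (hS : ∀ i, i ∈ S ↔ i ∉ s) :
    weight Δ = (∏ i ∈ S, smoothing (Δ i)) * weight fun i : s => Δ i := by
  classical
  have hS' : Sᶜ = s.toFinset := by
    ext i
    simp [hS]
  rw [weight, ← Finset.prod_mul_prod_compl S, hS', weight,
    ← Finset.prod_set_coe s (f := fun i => smoothing (Δ i))]

variable [DecidableEq V]

theorem weight_add_single (Δ : V → ZMod 2) (u : V) :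
    weight (Δ + Pi.single u 1) = weight Δ * smoothingChange (Δ u) := by
  rw [weight, weight, Fintype.prod_eq_mul_prod_compl u, Fintype.prod_eq_mul_prod_compl u]
  rw [Finset.prod_congr rfl (g := fun i => smoothing (Δ i)) (fun i hi => by
    have hi' : i ≠ u := by simpa using hi
    simp [hi'])]
  simp only [Pi.add_apply, Pi.single_eq_same, smoothing_add_one]
  ring

/-- The term of the reduced bracket that belongs to the diagonal matrix `Δ`, for an arbitrary matrix
`K` in place of an adjacency matrix. -/
noncomputable def stateTerm (K : Matrix V V (ZMod 2)) (Δ : V → ZMod 2) : ℤ[T;T⁻¹] :=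
  weight Δ * circleValue ^ nullity (K + diagonal Δ)

/-- The reduced bracket of an arbitrary matrix over `GF(2)`. -/
noncomputable def stateSum (K : Matrix V V (ZMod 2)) : ℤ[T;T⁻¹] := ∑ Δ, stateTerm K Δ

theorem stateSum_submatrix_equiv {W : Type*} [Fintype W] [DecidableEq W] (e : V ≃ W)
    (K : Matrix W W (ZMod 2)) : stateSum (K.submatrix e e) = stateSum K := by
  refine Fintype.sum_equiv (e.arrowCongr (Equiv.refl _)) _ _ fun Δ => ?_
  have h1 : weight (e.arrowCongr (Equiv.refl (ZMod 2)) Δ) = weight Δ :=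
    (Fintype.prod_equiv e _ _ fun i => by simp).symm
  have h2 : K.submatrix e e + diagonal Δ =
      (K + diagonal (e.arrowCongr (Equiv.refl (ZMod 2)) Δ)).submatrix e e := by
    rw [submatrix_add, Pi.add_apply, Pi.add_apply, submatrix_diagonal_equiv]
    congr 2
    ext i
    simp
  rw [stateTerm, stateTerm, h1, h2, nullity_submatrix_equiv]

/-- The effect of the first Reidemeister move on the reduced bracket. -/
theorem stateSum_of_isolated {K : Matrix V V (ZMod 2)} (hK : K.IsSymm) {v : V}
    (hv : ∀ x, x ≠ v → K x v = 0) (s : Set V) [Fintype s] (hs : ∀ i, i ∈ s ↔ i ≠ v) :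
    stateSum K = -T (if K v v = 0 then 3 else -3) *
      stateSum (K.submatrix (Subtype.val : s → V) Subtype.val) := by
  have hS (i : V) : i ∈ ({v} : Finset V) ↔ i ∉ s := by simp [hs]
  rw [stateSum, sum_eq_sum_filter_sum_powerset (fun _ => K v v) _ {v}, stateSum, Finset.mul_sum,
    ← sum_filter_restrict (fun _ => K v v) s hS]
  refine Finset.sum_congr rfl fun Δ hΔ => ?_
  have hΔv : Δ v = K v v := by simpa using hΔ
  set M := K + diagonal Δ with hM
  have hMs : M.IsSymm := isSymm_add_diagonal hK Δ
  have hcol : M *ᵥ Pi.single v 1 = 0 := by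
    ext i
    rcases eq_or_ne i v with rfl | hi
    · simp [hM, hΔv, CharTwo.add_self_eq_zero]
    · simp [hM, hv i hi, hi]
  have hn1 : nullity M = nullity (M + diagonal (Pi.single v 1)) + 1 :=
    nullity_eq_nullity_add_single hMs hcol (by simp)
  have hn2 : nullity (M + diagonal (Pi.single v 1)) =
      nullity (K.submatrix (Subtype.val : s → V) Subtype.val + diagonal fun i : s => Δ i) := by
    rw [nullity_eq_nullity_submatrix (s := s) (g := Pi.single v 1) (isSymm_add_diagonal hMs _)]
    · congr 1
      ext i j
      have hi : (i : V) ≠ v := (hs i).1 i.2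
      have hj : (j : V) ≠ v := (hs j).1 j.2
      simp [hM, diagonal_apply, Subtype.ext_iff, hi]
    · rw [add_mulVec, hcol, zero_add]
      ext i
      simp [mulVec_diagonal, Pi.single_apply]
    · intro i hi
      simp [(hs i).1 hi]
    · intro i hi
      rw [← hS] at hi
      simp [Finset.mem_singleton.1 hi]
    · refine fun x hx => ⟨x v, fun i hi => ?_⟩
      rw [← hS] at hi
      rw [Finset.mem_singleton.1 hi]
  rw [sum_powerset_singleton, Finset.sum_empty, add_zero, Finset.sum_singleton, stateTerm,
    stateTerm, add_diagonal_add, ← hM, hn1, hn2, stateTerm, weight_add_single,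
    weight_restrict Δ s hS, Finset.prod_singleton, hΔv]
  have key : smoothing (K v v) * (circleValue + smoothingChange (K v v)) =
      -T (if K v v = 0 then 3 else -3) := by
    rw [smoothing, smoothingChange, circleValue]
    split_ifs
    · simp only [mul_add, mul_sub, mul_neg, ← T_add]
      norm_num
    · simp only [mul_add, mul_sub, mul_neg, ← T_add]
      norm_num
      ring
  rw [← key]
  ring

/-- The invariance of the reduced bracket under the second Reidemeister move. -/
theorem stateSum_of_twins {K : Matrix V V (ZMod 2)} (hK : K.IsSymm) {v w : V}
    (hv : K v v = 1) (hw : K w w = 0) (hvw : ∀ x, x ≠ v → x ≠ w → K x v = K x w)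
    (s : Set V) [Fintype s] (hs : ∀ i, i ∈ s ↔ i ≠ v ∧ i ≠ w) :
    stateSum K = stateSum (K.submatrix (Subtype.val : s → V) Subtype.val) := by
  have hne : v ≠ w := by
    rintro rfl
    simp [hv] at hw
  have hS (i : V) : i ∈ ({v, w} : Finset V) ↔ i ∉ s := by
    rw [hs, Finset.mem_insert, Finset.mem_singleton]
    tauto
  -- If `Δ` agrees with `κ` at `v` and `w`, then `e_v + e_w` is in the kernel of `K + diagonal Δ`.
  set κ : V → ZMod 2 := fun i => K i v + K i w with hκ
  rw [stateSum, sum_eq_sum_filter_sum_powerset κ _ {v, w}, stateSum,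
    ← sum_filter_restrict κ s hS]
  refine Finset.sum_congr rfl fun Δ hΔ => ?_
  obtain ⟨hΔv, hΔw⟩ : Δ v = κ v ∧ Δ w = κ w := by simpa using hΔ
  have hκv : κ v = 1 + κ w := by
    simp only [hκ, hv, hw, hK.apply, add_zero]
  set M := K + diagonal Δ with hM
  set g : V → ZMod 2 := Pi.single v 1 + Pi.single w 1 with hg
  have hMs : M.IsSymm := isSymm_add_diagonal hK Δ
  have hcol : M *ᵥ g = 0 := by
    ext i
    by_cases hi : i = v
    · subst hi
      simp [hM, hg, mulVec_add, hΔv, hκ, hne, add_right_comm, CharTwo.add_self_eq_zero]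
    by_cases hi' : i = w
    · subst hi'
      simp only [hM, hg, mulVec_add, hΔw, hκ, Pi.add_apply, mulVec_single_one, col_apply,
        Matrix.add_apply, diagonal_apply_eq, diagonal_apply_ne _ hi, Pi.zero_apply]
      linear_combination (K i v + K i i) * CharTwo.two_eq_zero (R := ZMod 2)
    · simp [hM, hg, mulVec_add, hi, hi', hvw i hi hi', CharTwo.add_self_eq_zero]
  have hgv : g v = 1 := by simp [hg, hne]
  have hgw : g w = 1 := by simp [hg, hne.symm]
  have hcol' : diagonal g *ᵥ g = g := by
    ext i
    rw [mulVec_diagonal]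
    generalize g i = x
    revert x
    decide
  have hd : (M + diagonal (Pi.single v 1)) + diagonal (Pi.single w 1) = M + diagonal g := by
    rw [hg, add_diagonal_add]
  have hn1 : nullity M = nullity (M + diagonal (Pi.single v 1)) + 1 :=
    nullity_eq_nullity_add_single hMs hcol hgv
  have hn2 : nullity M = nullity (M + diagonal (Pi.single w 1)) + 1 :=
    nullity_eq_nullity_add_single hMs hcol hgw
  have hn3 : nullity (M + diagonal g) =
      nullity (K.submatrix (Subtype.val : s → V) Subtype.val + diagonal fun i : s => Δ i) := by
    rw [nullity_eq_nullity_submatrix (s := s) (g := g) (isSymm_add_diagonal hMs _)]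
    · congr 1
      ext i j
      have hi := (hs i).1 i.2
      simp [hM, hg, diagonal_apply, Subtype.ext_iff, hi]
    · rw [add_mulVec, hcol, zero_add, hcol']
    · intro i hi
      simp [hg, (hs i).1 hi]
    · intro i hi
      rw [← hS, Finset.mem_insert, Finset.mem_singleton] at hi
      rcases hi with rfl | rfl <;> assumption
    · refine fun x hx => ⟨x v, fun i hi => ?_⟩
      rw [← hS, Finset.mem_insert, Finset.mem_singleton] at hi
      rcases hi with rfl | rfl
      · rfl
      · rw [hg, add_dotProduct, single_one_dotProduct, single_one_dotProduct] at hx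
        exact (CharTwo.add_eq_zero.1 hx).symm
  have hΔ' : (Δ + (Pi.single v 1 : V → ZMod 2)) w = Δ w := by simp [hne.symm]
  have key : circleValue + smoothingChange (Δ v) + smoothingChange (Δ w) = 0 ∧
      smoothing (Δ v) * smoothing (Δ w) = 1 ∧
      smoothingChange (Δ v) * smoothingChange (Δ w) = 1 := by
    rw [hΔv, hΔw, hκv]
    generalize κ w = x
    obtain rfl | rfl : x = 0 ∨ x = 1 := by revert x; decide
    · simp only [smoothing, smoothingChange, circleValue, add_zero, if_pos, one_ne_zero, if_false]
      exact ⟨by ring, by rw [mul_comm, T_one_mul_T_neg_one], T_two_mul_T_neg_two⟩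
    · simp only [smoothing, smoothingChange, circleValue, CharTwo.add_self_eq_zero, if_pos,
        one_ne_zero, if_false]
      exact ⟨by ring, T_one_mul_T_neg_one, by rw [mul_comm, T_two_mul_T_neg_two]⟩
  obtain ⟨h1, h2, h3⟩ := key
  rw [sum_powerset_pair _ hne, Finset.sum_pair hne]
  simp only [Finset.sum_empty, add_zero, Finset.sum_singleton, stateTerm, add_diagonal_add,
    ← add_assoc]
  simp only [weight_add_single, hΔ']
  rw [← hM, hd, hn3, weight_restrict Δ s hS, Finset.prod_pair hne, h2]
  have hn2' : nullity (M + diagonal (Pi.single w 1)) =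
      nullity (M + diagonal (Pi.single v 1)) := by
    lia
  rw [hn1, hn2']
  linear_combination (weight fun i : s => Δ i) *
    (circleValue ^ nullity (M + diagonal (Pi.single v 1)) * h1 +
      circleValue ^ nullity (submatrix K (Subtype.val : s → V) Subtype.val +
        diagonal fun i : s => Δ i) * h3)

/-- The invariance of the reduced bracket under the third Reidemeister move. The last hypothesis,
that the row sums in the block `{u, v, w}` are not all equal, is what the six configurations have in
common. -/
theorem stateSum_add_triangleMatrix {K : Matrix V V (ZMod 2)} (hK : K.IsSymm) {u v w : V}
    (huv : u ≠ v) (huw : u ≠ w) (hvw : v ≠ w)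
    (hout : ∀ x, x ≠ u → x ≠ v → x ≠ w → K x u + K x v + K x w = 0)
    (hne : ¬ (K u u + K u v + K u w = K v u + K v v + K v w ∧
      K v u + K v v + K v w = K w u + K w v + K w w)) :
    stateSum (K + triangleMatrix u v w) = stateSum K := by
  -- If `Δ` agrees with `κ` on the block, then `e_u + e_v + e_w` is in the kernel of
  -- `K + diagonal Δ`.
  set κ : V → ZMod 2 := fun i => K i u + K i v + K i w with hκ
  rw [stateSum, sum_eq_sum_filter_sum_powerset κ _ {u, v, w}, stateSum,
    sum_eq_sum_filter_sum_powerset κ _ {u, v, w}]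
  refine Finset.sum_congr rfl fun Δ hΔ => ?_
  obtain ⟨hΔu, hΔv, hΔw⟩ : Δ u = κ u ∧ Δ v = κ v ∧ Δ w = κ w := by simpa using hΔ
  set E := triangleMatrix u v w with hE
  set M := K + diagonal Δ with hM
  have hMs : M.IsSymm := isSymm_add_diagonal hK Δ
  have hMs' : (M + E).IsSymm := hMs.add (isSymm_triangleMatrix u v w)
  have hEE : E + E = 0 := triangleMatrix_add_self u v w
  set g : V → ZMod 2 := Pi.single u 1 + Pi.single v 1 + Pi.single w 1 with hg
  have hcol : M *ᵥ g = 0 := by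
    have hKg : K *ᵥ g = κ := by
      ext i
      simp [hg, mulVec_add, hκ]
    ext i
    rw [hM, add_mulVec, hKg, Pi.add_apply, mulVec_diagonal]
    by_cases hi : i = u
    · subst hi
      simp [hg, hΔu, huv, huw, CharTwo.add_self_eq_zero]
    by_cases hi' : i = v
    · subst hi'
      simp [hg, hΔv, hi, hvw, CharTwo.add_self_eq_zero]
    by_cases hi'' : i = w
    · subst hi''
      simp [hg, hΔw, hi, hi', CharTwo.add_self_eq_zero]
    · simp [hg, hi, hi', hi'', hκ, hout i hi hi' hi'']
  have hcol' : (M + E) *ᵥ g = 0 := by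
    rw [add_mulVec, hcol, hE, hg, triangleMatrix_mulVec huv huw hvw, add_zero]
  have hgu : g u = 1 := by simp [hg, huv, huw]
  have hgv : g v = 1 := by simp [hg, huv.symm, hvw]
  have hgw : g w = 1 := by simp [hg, huw.symm, hvw.symm]
  have p1 := nullity_eq_nullity_add_single hMs hcol hgu
  have p2 := nullity_eq_nullity_add_single hMs hcol hgv
  have p3 := nullity_eq_nullity_add_single hMs hcol hgw
  have q1 := nullity_eq_nullity_add_single hMs' hcol' hgu
  have q2 := nullity_eq_nullity_add_single hMs' hcol' hgv
  have q3 := nullity_eq_nullity_add_single hMs' hcol' hgw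
  have p4 := nullity_add_single_eq_triangle hMs huv huw hvw hcol
  have q4 := nullity_add_single_eq_triangle hMs' huv huw hvw hcol'
  rw [← hE, add_assoc M E E, hEE, add_zero] at q4
  rw [← hE] at p4
  have r1 := nullity_add_single_add_single_eq_triangle hMs huv huw hvw hcol
  have r2 := nullity_add_single_add_single_eq_triangle hMs huw huv hvw.symm
    (by rw [← hcol, hg]; congr 1; abel)
  have r3 := nullity_add_single_add_single_eq_triangle hMs hvw huv.symm huw.symm
    (by rw [← hcol, hg]; congr 1; abel)
  rw [← hE] at r1
  rw [← triangleMatrix_comm_right, ← hE] at r2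
  rw [triangleMatrix_comm_right, triangleMatrix_comm_left, ← hE] at r3
  have huvw : u ∉ ({v, w} : Finset V) := by simp [huv, huw]
  rw [sum_powerset_triple _ huv huw hvw, sum_powerset_triple _ huv huw hvw]
  have hME : K + E + diagonal Δ = M + E := by rw [hM]; abel
  simp only [Finset.sum_empty, Finset.sum_pair huv, Finset.sum_pair huw, Finset.sum_pair hvw,
    Finset.sum_insert huvw, add_zero, Finset.sum_singleton, stateTerm, add_diagonal_add,
    ← add_assoc]
  have hw1 (i j : V) (hij : i ≠ j) (Θ : V → ZMod 2) : (Θ + (Pi.single i 1 : V → ZMod 2)) j =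
      Θ j := by
    simp [hij.symm]
  simp only [hME, ← hM, r1, r2, r3, p4, q4, weight_add_single, hw1 _ _ huv, hw1 _ _ huw,
    hw1 _ _ hvw]
  have e2 : nullity (M + diagonal (Pi.single v 1)) = nullity (M + diagonal (Pi.single u 1)) := by
    lia
  have e3 : nullity (M + diagonal (Pi.single w 1)) = nullity (M + diagonal (Pi.single u 1)) := by
    lia
  have f2 : nullity (M + E + diagonal (Pi.single v 1)) =
      nullity (M + E + diagonal (Pi.single u 1)) := by
    lia
  have f3 : nullity (M + E + diagonal (Pi.single w 1)) =
      nullity (M + E + diagonal (Pi.single u 1)) := by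
    lia
  rw [e2, e3, f2, f3, p1, q1]
  -- Two of the three ratios are `A²` and `A⁻²`, so both sides equal the third ratio.
  have key : circleValue + smoothingChange (Δ u) + smoothingChange (Δ v) +
      smoothingChange (Δ w) =
        smoothingChange (Δ u) * smoothingChange (Δ v) * smoothingChange (Δ w) := by
    rw [hΔu, hΔv, hΔw]
    change ¬ (κ u = κ v ∧ κ v = κ w) at hne
    revert hne
    generalize κ u = x
    generalize κ v = y
    generalize κ w = z
    intro hne
    have h01 (a : ZMod 2) : a = 0 ∨ a = 1 := by revert a; decide
    obtain rfl | rfl := h01 x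
    all_goals obtain rfl | rfl := h01 y
    all_goals obtain rfl | rfl := h01 z
    all_goals
      first
      | exact absurd ⟨rfl, rfl⟩ hne
      | simp only [smoothingChange, circleValue, if_pos, one_ne_zero, if_false]
        linear_combination (-T 2) * T_two_mul_T_neg_two
      | simp only [smoothingChange, circleValue, if_pos, one_ne_zero, if_false]
        linear_combination (-T (-2)) * T_two_mul_T_neg_two
  -- The three terms with an even, positive number of changes agree on both sides. The others
  -- involve only two powers of `circleValue`, which toggling interchanges; by `key` they have
  -- the same coefficient.
  linear_combination weight Δ * (circleValue ^ nullity (M + E + diagonal (Pi.single u 1)) -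
    circleValue ^ nullity (M + diagonal (Pi.single u 1))) * key

end StateSum

/-! ### Graphs and their Jones polynomials -/

section Graph

open LaurentPolynomial

variable {V W : Type*}

theorem Adj.symm_iff (G : LoopedGraph V) (x y : V) : G.Adj x y ↔ G.Adj y x := by
  rw [Adj, Adj, Sym2.eq_swap]

theorem adjMatrix_of_adj {G : LoopedGraph V} {x y : V} (h : G.Adj x y) : G.adjMatrix x y = 1 := by
  simp [adjMatrix, h]

theorem adjMatrix_of_not_adj {G : LoopedGraph V} {x y : V} (h : ¬ G.Adj x y) :
    G.adjMatrix x y = 0 := by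
  simp [adjMatrix, h]

theorem adjMatrix_congr {G : LoopedGraph V} {H : LoopedGraph W} {x y : V} {x' y' : W}
    (h : G.Adj x y ↔ H.Adj x' y') : G.adjMatrix x y = H.adjMatrix x' y' := by
  by_cases hxy : G.Adj x y
  · rw [adjMatrix_of_adj hxy, adjMatrix_of_adj (h.1 hxy)]
  · rw [adjMatrix_of_not_adj hxy, adjMatrix_of_not_adj (mt h.2 hxy)]

theorem isSymm_adjMatrix (G : LoopedGraph V) : G.adjMatrix.IsSymm := by
  ext i j
  exact adjMatrix_congr (Adj.symm_iff G j i)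

theorem adj_induce (G : LoopedGraph V) (s : Set V) (x y : s) :
    (G.induce s).Adj x y ↔ G.Adj x y := by
  simp [Adj, induce]

theorem adjMatrix_induce (G : LoopedGraph V) (s : Set V) :
    (G.induce s).adjMatrix = G.adjMatrix.submatrix (Subtype.val : s → V) Subtype.val := by
  ext i j
  exact adjMatrix_congr (G.adj_induce s i j)

theorem reducedBracket_eq_stateSum [Fintype V] [DecidableEq V] (G : LoopedGraph V) :
    G.reducedBracket = stateSum G.adjMatrix := by
  -- The definition of the bracket uses the classical decidability instance.
  obtain rfl : ‹DecidableEq V› = fun a b => Classical.propDecidable (a = b) :=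
    Subsingleton.elim _ _
  classical
  simp only [reducedBracket, bracket, map_sum, map_mul, map_pow, MvPolynomial.aeval_X, stateSum,
    stateTerm]
  refine Finset.sum_congr rfl fun Δ _ => ?_
  congr 1
  have hr : (diagonal Δ).rank = (Finset.univ.filter fun i => ¬ Δ i = 0).card := by
    rw [rank_diagonal, Fintype.card_subtype]
  have hn : nullity (diagonal Δ) = (Finset.univ.filter fun i => Δ i = 0).card := by
    have h := nullity_add_rank (diagonal Δ)
    rw [hr, ← Finset.card_univ,
      ← Finset.card_filter_add_card_filter_not (s := Finset.univ) (fun i => Δ i = 0)] at h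
    exact Nat.add_right_cancel h
  rw [hn, hr, weight, ← Finset.prod_filter_mul_prod_filter_not Finset.univ (fun i => Δ i = 0),
    Finset.prod_congr rfl (s₁ := {i | Δ i = 0}) (g := fun _ => T 1),
    Finset.prod_congr (s₁ := {i | ¬ Δ i = 0}) rfl
      (g := fun _ => T (-1)),
    Finset.prod_const, Finset.prod_const]
  · rfl
  · intro i hi
    simp [smoothing, (Finset.mem_filter.1 hi).2]
  · intro i hi
    simp [smoothing, (Finset.mem_filter.1 hi).2]

theorem numLoops_eq_of_isIso {G : LoopedGraph V} {H : LoopedGraph W} (h : G.IsIso H) :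
    G.numLoops = H.numLoops := by
  obtain ⟨e, he⟩ := h
  exact Set.ncard_congr' (e.subtypeEquiv fun x => he x x)

theorem jones_eq_of_isIso [Fintype V] [Fintype W] {G : LoopedGraph V} {H : LoopedGraph W}
    (h : G.IsIso H) : G.jones = H.jones := by
  classical
  have hl := numLoops_eq_of_isIso h
  obtain ⟨e, he⟩ := h
  have hA : G.adjMatrix = H.adjMatrix.submatrix e e := by
    ext i j
    exact adjMatrix_congr (he i j)
  rw [jones, jones, hl, Fintype.card_congr e, reducedBracket_eq_stateSum,
    reducedBracket_eq_stateSum, hA, stateSum_submatrix_equiv]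

/-- The loops of `G` lie either off `s` or in the subgraph spanned by `s`. -/
theorem numLoops_eq_add_numLoops_induce [Finite V] (G : LoopedGraph V) (s : Set V) :
    G.numLoops = {x | x ∉ s ∧ G.Adj x x}.ncard + (G.induce s).numLoops := by
  have h1 : (G.induce s).numLoops = {x | x ∈ s ∧ G.Adj x x}.ncard := by
    rw [numLoops, ← Set.ncard_image_of_injective _ Subtype.val_injective]
    congr 1
    ext x
    simp [adj_induce, and_comm]
  rw [h1, ← Set.ncard_union_eq]
  · rw [numLoops]
    congr 1
    ext x
    simp only [Set.mem_ofPred_eq, Set.mem_union]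
    tauto
  · rw [Set.disjoint_left]
    simp +contextual


theorem card_eq_card_add_card [Fintype V] (s : Set V) [Fintype s] {S : Finset V}
    (hS : ∀ i, i ∈ S ↔ i ∉ s) : Fintype.card V = Fintype.card s + S.card := by
  classical
  have h : Sᶜ = s.toFinset := by
    ext i
    simp [hS]
  rw [← Set.toFinset_card s, ← h, Finset.card_compl_add_card]

theorem jones_eq_of_omega1 [Fintype V] [Fintype W] {G : LoopedGraph V} {H : LoopedGraph W}
    (h : G.Omega1 H) : G.jones = H.jones := by
  classical
  obtain ⟨v, hv, hiso⟩ := h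
  rw [jones_eq_of_isIso hiso]
  have hcard := card_eq_card_add_card {x : W | x ≠ v} (S := {v}) (by simp)
  have hsum := stateSum_of_isolated H.isSymm_adjMatrix
    (fun x hx => adjMatrix_of_not_adj (hv x hx)) {x | x ≠ v} (fun _ => Iff.rfl)
  have hloops := H.numLoops_eq_add_numLoops_induce {x | x ≠ v}
  rw [jones, jones, reducedBracket_eq_stateSum, reducedBracket_eq_stateSum, adjMatrix_induce,
    hsum, hloops, hcard, map_mul, map_neg, invert_T, Finset.card_singleton]
  generalize invert (stateSum (H.adjMatrix.submatrix (Subtype.val : {x : W | x ≠ v} → W)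
    Subtype.val)) = R
  generalize Fintype.card {x : W | x ≠ v} = n
  generalize (H.induce {x : W | x ≠ v}).numLoops = l
  have h3 : (T 3 * T (-3) : ℤ[T;T⁻¹]) = 1 := by rw [← T_add, add_neg_cancel, T_zero]
  by_cases hl : H.Adj v v
  · have hset : {x | x ∉ {x | x ≠ v} ∧ H.Adj x x} = {v} := by
      ext x
      simp +contextual [hl]
    rw [hset, Set.ncard_singleton, adjMatrix_of_adj hl, if_neg one_ne_zero, neg_neg, pow_succ,
      show (3 * ((n + 1 : ℕ) : ℤ) - 6 * ((1 + l : ℕ) : ℤ)) = 3 * n - 6 * l + -3 by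
        push_cast; ring, T_add]
    linear_combination (-(-1) ^ n * T (3 * n - 6 * l) * R) * h3
  · have hset : {x | x ∉ {x | x ≠ v} ∧ H.Adj x x} = ∅ := by
      ext x
      simp +contextual [hl]
    rw [hset, Set.ncard_empty, adjMatrix_of_not_adj hl, if_pos rfl, pow_succ,
      show (3 * ((n + 1 : ℕ) : ℤ) - 6 * ((0 + l : ℕ) : ℤ)) = 3 * n - 6 * l + 3 by
        push_cast; ring, T_add]
    linear_combination (-(-1) ^ n * T (3 * n - 6 * l) * R) * h3

theorem jones_eq_of_omega2 [Fintype V] [Fintype W] {G : LoopedGraph V} {H : LoopedGraph W}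
    (h : G.Omega2 H) : G.jones = H.jones := by
  classical
  obtain ⟨v, w, hv, hw, hvw, hiso⟩ := h
  rw [jones_eq_of_isIso hiso]
  have hne : v ≠ w := by
    rintro rfl
    exact hw hv
  have hcard := card_eq_card_add_card {x : W | x ≠ v ∧ x ≠ w} (S := {v, w}) (by grind)
  have hsum := stateSum_of_twins H.isSymm_adjMatrix (adjMatrix_of_adj hv) (adjMatrix_of_not_adj hw)
    (fun x hxv hxw => adjMatrix_congr (hvw x hxv hxw)) {x | x ≠ v ∧ x ≠ w} (fun _ => Iff.rfl)
  have hloops := H.numLoops_eq_add_numLoops_induce {x | x ≠ v ∧ x ≠ w}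
  have hset : {x | x ∉ {x | x ≠ v ∧ x ≠ w} ∧ H.Adj x x} = {v} := by
    ext x
    by_cases hxv : x = v
    · simp [hxv, hv]
    by_cases hxw : x = w
    · simp [hxw, hw, hne.symm]
    · simp [hxv, hxw]
  rw [hset, Set.ncard_singleton] at hloops
  rw [jones, jones, reducedBracket_eq_stateSum, reducedBracket_eq_stateSum, adjMatrix_induce, hsum,
    hloops, hcard, Finset.card_pair hne]
  generalize invert (stateSum (H.adjMatrix.submatrix (Subtype.val : {x : W | x ≠ v ∧ x ≠ w} → W)
    Subtype.val)) = R
  generalize Fintype.card {x : W | x ≠ v ∧ x ≠ w} = n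
  generalize (H.induce {x : W | x ≠ v ∧ x ≠ w}).numLoops = l
  rw [pow_add, neg_one_sq, mul_one,
    show (3 * ((n + 2 : ℕ) : ℤ) - 6 * ((1 + l : ℕ) : ℤ)) = 3 * n - 6 * l by push_cast; ring]

theorem adjMatrix_toggle [DecidableEq V] (G : LoopedGraph V) {u v w : V} (huv : u ≠ v) (huw : u ≠ w)
    (hvw : v ≠ w) :
    (G.toggle u v w).adjMatrix = G.adjMatrix + triangleMatrix u v w := by
  classical
  ext i j
  have htri : triangleMatrix u v w i j =
      if s(i, j) ∈ ({s(u, v), s(u, w), s(v, w)} : Set (Sym2 V)) then 1 else 0 := by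
    simp only [triangleMatrix, Matrix.add_apply, vecMulVec_apply, Pi.single_apply,
      Set.mem_insert_iff, Set.mem_singleton_iff, Sym2.eq_iff]
    by_cases hiu : i = u
    · subst hiu
      by_cases hjv : j = v
      · subst hjv
        simp [huv, huw, hvw, huv.symm]
      · simp [huv, huw, hjv]
    by_cases hiv : i = v
    · subst hiv
      by_cases hju : j = u
      · subst hju
        simp [huw, hvw, huv.symm, huv]
      · simp [hju, hvw, huv.symm]
    by_cases hiw : i = w
    · subst hiw
      by_cases hju : j = u
      · subst hju
        simp [huv, huw, hiu, hiv]
      · simp [hju, hiu, hiv]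
    · simp [hiu, hiv, hiw]
  rw [Matrix.add_apply, htri]
  by_cases hG : s(i, j) ∈ G.edges <;>
    by_cases hT : s(i, j) ∈ ({s(u, v), s(u, w), s(v, w)} : Set (Sym2 V))
  · rw [adjMatrix_of_adj (show G.Adj i j from hG), if_pos hT, adjMatrix_of_not_adj]
    · rfl
    · simp [Adj, toggle, Set.mem_symmDiff, -Set.mem_insert_iff, -Set.mem_singleton_iff, hG, hT]
  · rw [adjMatrix_of_adj (show G.Adj i j from hG), if_neg hT, adjMatrix_of_adj]
    · rfl
    · simp [Adj, toggle, Set.mem_symmDiff, -Set.mem_insert_iff, -Set.mem_singleton_iff, hG, hT]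
  · rw [adjMatrix_of_not_adj (show ¬ G.Adj i j from hG), if_pos hT, adjMatrix_of_adj]
    · rfl
    · simp [Adj, toggle, Set.mem_symmDiff, -Set.mem_insert_iff, -Set.mem_singleton_iff, hG, hT]
  · rw [adjMatrix_of_not_adj (show ¬ G.Adj i j from hG), if_neg hT, adjMatrix_of_not_adj]
    · rfl
    · simp [Adj, toggle, Set.mem_symmDiff, -Set.mem_insert_iff, -Set.mem_singleton_iff, hG, hT]

theorem numLoops_toggle (G : LoopedGraph V) {u v w : V} (huv : u ≠ v) (huw : u ≠ w)
    (hvw : v ≠ w) : (G.toggle u v w).numLoops = G.numLoops := by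
  have h (x : V) : s(x, x) ∉ ({s(u, v), s(u, w), s(v, w)} : Set (Sym2 V)) := by
    simp only [Set.mem_insert_iff, Set.mem_singleton_iff, Sym2.eq_iff]
    grind
  rw [numLoops, numLoops]
  congr 1
  ext x
  simp [Adj, toggle, Set.mem_symmDiff, -Set.mem_insert_iff, -Set.mem_singleton_iff, h]

theorem natCast_ncard_eq_sum_adjMatrix (G : LoopedGraph V) {u v w : V} (huv : u ≠ v)
    (huw : u ≠ w) (hvw : v ≠ w) (x : V) :
    (({y ∈ ({u, v, w} : Set V) | G.Adj x y}.ncard : ℕ) : ZMod 2) =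
      G.adjMatrix x u + G.adjMatrix x v + G.adjMatrix x w := by
  classical
  have h : {y ∈ ({u, v, w} : Set V) | G.Adj x y} =
      ((({u, v, w} : Finset V).filter fun y => G.Adj x y : Finset V) : Set V) := by
    ext y
    simp
  rw [h, Set.ncard_coe_finset, Finset.card_filter, Nat.cast_sum,
    Finset.sum_insert (by simp [huv, huw]), Finset.sum_pair hvw, ← add_assoc]
  have hy (y : V) : ((if G.Adj x y then 1 else 0 : ℕ) : ZMod 2) = G.adjMatrix x y := by
    by_cases hxy : G.Adj x y
    · simp [adjMatrix_of_adj hxy, hxy]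
    · simp [adjMatrix_of_not_adj hxy, hxy]
  rw [hy, hy, hy]

/-- All vertices have degrees of the same parity, where a loop counts once. -/
def DegreeParityConst [Fintype V] (G : LoopedGraph V) : Prop :=
  ∀ i j, ∑ l, G.adjMatrix i l = ∑ l, G.adjMatrix j l

theorem IsIso.degreeParityConst [Fintype V] [Fintype W] {G : LoopedGraph V} {H : LoopedGraph W}
    (h : G.IsIso H) (hG : G.DegreeParityConst) : H.DegreeParityConst := by
  obtain ⟨e, he⟩ := h
  have hsum (i : V) : ∑ l, G.adjMatrix i l = ∑ l, H.adjMatrix (e i) l :=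
    Fintype.sum_equiv e _ _ fun l => adjMatrix_congr (he i l)
  intro i j
  have := hG (e.symm i) (e.symm j)
  rwa [hsum, hsum, e.apply_symm_apply, e.apply_symm_apply] at this

theorem not_degreeParityConst_omega3Graph (k : Fin 6) :
    ¬ (omega3Graph k).DegreeParityConst := by
  intro h
  have h01 := h 0 1
  have h02 := h 0 2
  simp only [Fin.sum_univ_three] at h01 h02
  revert h01 h02
  fin_cases k <;> simp [omega3Graph, adjMatrix, Adj]

theorem degreeParityConst_induce_triple [Fintype V] {G : LoopedGraph V} {u v w : V}
    [Fintype ({u, v, w} : Set V)] (huv : u ≠ v) (huw : u ≠ w) (hvw : v ≠ w) :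
    (G.induce {u, v, w}).DegreeParityConst ↔
      G.adjMatrix u u + G.adjMatrix u v + G.adjMatrix u w =
          G.adjMatrix v u + G.adjMatrix v v + G.adjMatrix v w ∧
        G.adjMatrix v u + G.adjMatrix v v + G.adjMatrix v w =
          G.adjMatrix w u + G.adjMatrix w v + G.adjMatrix w w := by
  classical
  have hsum (i : ({u, v, w} : Set V)) : ∑ l, (G.induce {u, v, w}).adjMatrix i l =
      G.adjMatrix i u + G.adjMatrix i v + G.adjMatrix i w := by
    simp only [adjMatrix_induce, submatrix_apply]
    rw [Finset.sum_set_coe ({u, v, w} : Set V) (f := fun l => G.adjMatrix i l)]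
    have h : ({u, v, w} : Set V).toFinset = {u, v, w} := by
      ext
      simp
    rw [h, Finset.sum_insert (by simp [huv, huw]), Finset.sum_pair hvw, add_assoc]
  simp only [DegreeParityConst, hsum]
  constructor
  · exact fun h => ⟨h ⟨u, by simp⟩ ⟨v, by simp⟩, h ⟨v, by simp⟩ ⟨w, by simp⟩⟩
  · rintro ⟨h1, h2⟩ ⟨i, rfl | rfl | rfl⟩ ⟨j, rfl | rfl | rfl⟩ <;> simp [h1, h2]

theorem jones_eq_of_omega3 [Fintype V] [Fintype W] {G : LoopedGraph V} {H : LoopedGraph W}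
    (h : G.Omega3 H) : G.jones = H.jones := by
  classical
  obtain ⟨u, v, w, huv, huw, hvw, hout, ⟨k, hk⟩, hiso⟩ := h
  rw [← jones_eq_of_isIso hiso]
  have hadj := G.adjMatrix_toggle huv huw hvw
  have hrow : ¬ (G.induce {u, v, w}).DegreeParityConst := by
    intro hpar
    refine not_degreeParityConst_omega3Graph k ?_
    rcases hk with hk | hk
    · exact hk.degreeParityConst hpar
    · refine hk.degreeParityConst ?_
      rw [degreeParityConst_induce_triple huv huw hvw] at hpar ⊢
      have ht (i : V) (hi : i = u ∨ i = v ∨ i = w) :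
          triangleMatrix u v w i u + triangleMatrix u v w i v + triangleMatrix u v w i w = 0 := by
        have := congrFun (triangleMatrix_mulVec huv huw hvw) i
        simpa [mulVec_add] using this
      simp only [hadj, Matrix.add_apply]
      have hu := ht u (by simp)
      have hv := ht v (by simp)
      have hw := ht w (by simp)
      exact ⟨by linear_combination hpar.1 + hu - hv, by linear_combination hpar.2 + hv - hw⟩
  rw [degreeParityConst_induce_triple huv huw hvw] at hrow
  have hsum := stateSum_add_triangleMatrix G.isSymm_adjMatrix huv huw hvw (fun x hxu hxv hxw => by
    rw [← natCast_ncard_eq_sum_adjMatrix G huv huw hvw]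
    by_cases hx : ∃ y ∈ ({u, v, w} : Set V), G.Adj x y
    · rw [hout x (by simp [hxu, hxv, hxw]) hx]
      rfl
    · have hempty : {y ∈ ({u, v, w} : Set V) | G.Adj x y} = ∅ := by
        ext y
        simpa using fun hy h => hx ⟨y, by simpa using hy, h⟩
      rw [hempty, Set.ncard_empty, Nat.cast_zero]) hrow
  rw [jones, jones, reducedBracket_eq_stateSum, reducedBracket_eq_stateSum, hadj, hsum,
    numLoops_toggle G huv huw hvw]

end Graph
end LoopedGraph

theorem theorem3 (G H : FiniteLoopedGraph.{u}) (h : G.ReidemeisterEquiv H) :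
    G.jones = H.jones := by
  induction h with
  | rel G H h =>
    rcases h with h | h | h
    · exact LoopedGraph.jones_eq_of_omega1 h
    · exact LoopedGraph.jones_eq_of_omega2 h
    · exact LoopedGraph.jones_eq_of_omega3 h
  | refl => rfl
  | symm _ _ _ ih => exact ih.symm
  | trans _ _ _ _ _ ih₁ ih₂ => exact ih₁.trans ih₂
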